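/- Let $\tilde\alpha$ be a real number. For real $\beta$ and $i\in\mathbb N_0$ put $$s_i(\beta)=(-1)^i\binom{\beta}{i}=(-1)^i\frac{\beta(\beta-1)\cdots(\beta-i+1)}{i!},$$ which equals $(-1)^i\frac{\Gamma(\beta+1)}{i!\,\Gamma(\beta-i+1)}$ whenever $\beta\notin\{-1,-2,\dots\}$ (with $1/\Gamma=0$ at the poles of $\Gamma$). Let $\omega$ be the set of complex sequences $x=(x_k)_{k=0}^\infty$, and let $\ell_\infty,c_0,c,\ell_1\subset\omega$ be the sets of bounded, null, convergent and absolutely summable sequences. For $x\in\omega$ let $(\Delta^{(\tilde\alpha)}x)_k=\sum_{i=0}^{k}s_i(\tilde\alpha)\,x_{k-i}$, and for $X\in\{\ell_\infty,c_0,c\}$ let $X(\Delta^{(\tilde\alpha)})=\{x\in\omega:\Delta^{(\tilde\alpha)}x\in X\}$. For $X,Y\subset\omega$, $(X,Y)$ denotes the class of all infinite complex matrices $A=(a_{nk})_{n,k=0}^\infty$ such that for every $x\in X$ all the series $A_nx=\sum_{k=0}^\infty a_{nk}x_k$ converge and $(A_nx)_{n=0}^\infty\in Y$. For an infinite complex matrix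 $A=(a_{nk})$ define, for $n,m,k\in\mathbb N_0$, $$\hat a_{nk}=\sum_{j=k}^\infty s_{j-k}(-\tilde\alpha)\,a_{nj},\qquad w^{(A_n)}_{mk}=\begin{cases}\sum_{j=m}^\infty s_{j-k}(-\tilde\alpha)\,a_{nj}&(0\le k\le m),\\ 0&(k>m).\end{cases}$$ Each list of conditions below includes the requirement that the series defining $\hat a_{nk}$ converge for all $n,k$ (then those defining $w^{(A_n)}_{mk}$ converge as well). Consider the conditions * (1A) $\sup_n\sum_{k=0}^\infty|\hat a_{nk}|<\infty$; * (1B) $\lim_{m\to\infty}\sum_{k=0}^m|w^{(A_n)}_{mk}|=0$ for all $n$; * (2A) $\sup_m\sum_{k=0}^m|w^{(A_n)}_{mk}|<\infty$ for all $n$; * (3A) $\gamma_n=\lim_{m\to\infty}\sum_{k=0}^m w^{(A_n)}_{mk}$ exists for all $n$; * (3B) $\sup_n\left|\sum_{k=0}^\infty\hat a_{nk}-\gamma_n\right|<\infty$; * (4A) $\sum_{k=0}^\infty|\hat a_{nk}|<\infty$ for all $n$ and $\lim_{n\to\infty}\sum_{k=0}^\infty|\hat a_{nk}|=0$; * (5A)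 $\lim_{n\to\infty}\hat a_{nk}=0$ for all $k$; * (6A) $\lim_{n\to\infty}\left(\sum_{k=0}^\infty\hat a_{nk}-\gamma_n\right)=0$; * (7A) $\hat\alpha_k=\lim_{n\to\infty}\hat a_{nk}$ exists for all $k$; * (7B) $\sum_{k=0}^\infty|\hat a_{nk}|<\infty$ for all $n$ and $\sum_{k=0}^\infty|\hat\alpha_k|<\infty$; * (7C) $\lim_{n\to\infty}\sum_{k=0}^\infty|\hat a_{nk}-\hat\alpha_k|=0$; * (9A) $\lim_{n\to\infty}\left(\sum_{k=0}^\infty\hat a_{nk}-\gamma_n\right)$ exists; * (10A) $\sup_{K\subset\mathbb N_0}\sum_{n=0}^\infty\left|\sum_{k\in K}\hat a_{nk}\right|<\infty$, where all the series $\sum_{k\in K}\hat a_{nk}$ converge; * (12A) $\sum_{n=0}^\infty\left|\sum_{k=0}^\infty\hat a_{nk}-\gamma_n\right|<\infty$. Then for every infinite complex matrix $A$, necessary and sufficient conditions for $A\in(X(\Delta^{(\tilde\alpha)}),Y)$ are those in the following table: | $Y$ | $X=\ell_\infty$ | $X=c_0$ | $X=c$ | |---|---|---|---| | $\ell_\infty$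 | 1A, 1B | 1A, 2A | 1A, 2A, 3A, 3B | | $c_0$ | 1B, 4A | 1A, 2A, 5A | 1A, 2A, 3A, 5A, 6A | | $c$ | 1B, 7A, 7B, 7C | 1A, 2A, 7A | 1A, 2A, 3A, 7A, 9A | | $\ell_1$ | 1B, 10A | 2A, 10A | 2A, 3A, 10A, 12A | -/

import Mathlib

open Filter Topology
open scoped ENNReal

namespace FracDiff

/-! ### Sequences, series and matrix classes

Sequences are functions `ℕ → ℂ`, infinite matrices are functions `ℕ → ℕ → ℂ` (row, column).
All series of complex numbers are limits of their partial sums (so convergence may be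
conditional); series of absolute values are taken in `[0, ∞]`. -/

/-- The series `∑_{k=0}^∞ f k` converges, i.e. its partial sums converge. -/
def Converges (f : ℕ → ℂ) : Prop := Summable f (SummationFilter.conditional ℕ)

/-- The sum `∑_{k=0}^∞ f k`, the limit of the partial sums (only meaningful if `Converges f`). -/
noncomputable def series (f : ℕ → ℂ) : ℂ := ∑'[SummationFilter.conditional ℕ] k, f k

theorem converges_iff (f : ℕ → ℂ) :
    Converges f ↔ ∃ s, Tendsto (fun N => ∑ k ∈ Finset.range N, f k) atTop (𝓝 s) := by
  simp only [Converges, Summable, HasSum, SummationFilter.conditional_filter_eq_map_range,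
    tendsto_map'_iff, Function.comp_def]

theorem series_eq {f : ℕ → ℂ} {s : ℂ}
    (h : Tendsto (fun N => ∑ k ∈ Finset.range N, f k) atTop (𝓝 s)) : series f = s := by
  apply HasSum.tsum_eq
  simpa only [HasSum, SummationFilter.conditional_filter_eq_map_range,
    tendsto_map'_iff, Function.comp_def] using h

/-- Bounded sequences. -/
def ellInf : Set (ℕ → ℂ) := {x | BddAbove (Set.range fun k => ‖x k‖)}

/-- Null sequences. -/
def cZero : Set (ℕ → ℂ) := {x | Tendsto x atTop (𝓝 0)}

/-- Convergent sequences. -/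
def cConv : Set (ℕ → ℂ) := {x | ∃ l, Tendsto x atTop (𝓝 l)}

/-- Sequences with absolutely convergent series. -/
def ellOne : Set (ℕ → ℂ) := {x | Summable fun k => ‖x k‖}

/-- The class `(X, Y)`: for every `x ∈ X` all series `A_n x = ∑_k a_{nk} x_k` converge
and the sequence `Ax = (A_n x)_n` lies in `Y`. -/
def MatClass (X Y : Set (ℕ → ℂ)) : Set (ℕ → ℕ → ℂ) :=
  {A | ∀ x ∈ X, (∀ n, Converges fun k => A n k * x k) ∧
    (fun n => series fun k => A n k * x k) ∈ Y}

/-! ### Fractional differences -/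

/-- The coefficient `(-1)^i Γ(β+1) / (i! Γ(β-i+1)) = (-1)^i β(β-1)⋯(β-i+1)/i!`, expressed by the
generalized binomial coefficient, which also makes sense where `Γ(β+1)` has a pole. -/
noncomputable def coeff (β : ℝ) (i : ℕ) : ℝ := (-1) ^ i * Ring.choose β i

/-- Away from the poles of `Γ(β+1)`, the coefficient is the quotient of Gamma values
(with `1/Γ = 0` at the poles of `Γ(β-i+1)`; Mathlib has `Γ = 0` there, and `1/0 = 0`). -/
theorem coeff_eq_gamma (β : ℝ) (hβ : ∀ m : ℕ, β + 1 ≠ -m) (i : ℕ) :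
    coeff β i = (-1) ^ i * Real.Gamma (β + 1) / (i.factorial * Real.Gamma (β - i + 1)) := by
  have key : ∀ i : ℕ, (descPochhammer ℤ i).smeval β
      = Real.Gamma (β + 1) / Real.Gamma (β - i + 1) := by
    intro i
    induction i with
    | zero =>
      have := Real.Gamma_ne_zero hβ
      simp [this]
    | succ i ih =>
      have e : (β - ((i + 1 : ℕ) : ℝ) + 1) = β - i := by push_cast; ring
      rw [descPochhammer_succ_right, Polynomial.smeval_mul, ih, e]
      have h2 : (Polynomial.X - (i : Polynomial ℤ)).smeval β = β - i := by
        simp [Polynomial.smeval_sub, Polynomial.smeval_natCast]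
      rw [h2]
      by_cases h : β - i = 0
      · simp [h]
      · rw [Real.Gamma_add_one h]
        field_simp
  rw [coeff, Ring.choose_eq_smul, key i]
  simp only [smul_eq_mul]
  field_simp

/-- The transform `(Δ^(α) x)_k = ∑_i (-1)^i Γ(α+1)/(i! Γ(α-i+1)) x_{k-i}`,
where terms with negative index are zero. -/
noncomputable def fracDiff (α : ℝ) (x : ℕ → ℂ) (k : ℕ) : ℂ :=
  ∑ i ∈ Finset.range (k + 1), (coeff α i : ℂ) * x (k - i)

/-- The space `X(Δ^(α))` of all sequences whose `Δ^(α)`-transform lies in `X`. -/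
def fracSpace (X : Set (ℕ → ℂ)) (α : ℝ) : Set (ℕ → ℂ) := {x | fracDiff α x ∈ X}

/-! ### The matrices `Â` and `W^{(A_n)}` -/

/-- `â_{nk} = ∑_{j=k}^∞ (-1)^{j-k} Γ(-α+1)/((j-k)! Γ(-α-j+k+1)) a_{nj}`, with `j = k + i`. -/
noncomputable def hat (α : ℝ) (A : ℕ → ℕ → ℂ) (n k : ℕ) : ℂ :=
  series fun i => (coeff (-α) i : ℂ) * A n (k + i)

/-- All the series that define the entries of `Â` converge. -/
def HatDefined (α : ℝ) (A : ℕ → ℕ → ℂ) : Prop :=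
  ∀ n k, Converges fun i => (coeff (-α) i : ℂ) * A n (k + i)

/-- The entry `w_{mk}` of the triangle `W^{(A_n)}`: for `k ≤ m` it is
`∑_{j=m}^∞ (-1)^{j-k} Γ(-α+1)/((j-k)! Γ(-α-j+k+1)) a_{nj}`, with `j = m + i`. -/
noncomputable def wMat (α : ℝ) (A : ℕ → ℕ → ℂ) (n m k : ℕ) : ℂ :=
  if k ≤ m then series fun i => (coeff (-α) (m + i - k) : ℂ) * A n (m + i) else 0

/-! ### The conditions -/

/-- `sup_n ∑_k |â_{nk}| < ∞`. -/
def Cond1A (α : ℝ) (A : ℕ → ℕ → ℂ) : Prop :=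
  (⨆ n, ∑' k, ‖hat α A n k‖ₑ) < ∞

/-- `lim_m ∑_{k=0}^m |w_{mk}^{(A_n)}| = 0` for all `n`. -/
def Cond1B (α : ℝ) (A : ℕ → ℕ → ℂ) : Prop :=
  ∀ n, Tendsto (fun m => ∑ k ∈ Finset.range (m + 1), ‖wMat α A n m k‖) atTop (𝓝 0)

/-- `sup_m ∑_{k=0}^m |w_{mk}^{(A_n)}| < ∞` for all `n`. -/
def Cond2A (α : ℝ) (A : ℕ → ℕ → ℂ) : Prop :=
  ∀ n, (⨆ m, ∑ k ∈ Finset.range (m + 1), ‖wMat α A n m k‖ₑ) < ∞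

/-- `lim_m ∑_{k=0}^m w_{mk}^{(A_n)}` exists and equals `γ_n`, for all `n`. -/
def Cond3A (α : ℝ) (A : ℕ → ℕ → ℂ) (γ : ℕ → ℂ) : Prop :=
  ∀ n, Tendsto (fun m => ∑ k ∈ Finset.range (m + 1), wMat α A n m k) atTop (𝓝 (γ n))

/-- `sup_n |∑_k â_{nk} - γ_n| < ∞`. -/
def Cond3B (α : ℝ) (A : ℕ → ℕ → ℂ) (γ : ℕ → ℂ) : Prop :=
  (⨆ n, ‖series (hat α A n) - γ n‖ₑ) < ∞

/-- `∑_k |â_{nk}| < ∞` for all `n`, and `lim_n ∑_k |â_{nk}| = 0`. -/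
def Cond4A (α : ℝ) (A : ℕ → ℕ → ℂ) : Prop :=
  (∀ n, ∑' k, ‖hat α A n k‖ₑ < ∞) ∧
    Tendsto (fun n => ∑' k, ‖hat α A n k‖ₑ) atTop (𝓝 0)

/-- `lim_n â_{nk} = 0` for all `k`. -/
def Cond5A (α : ℝ) (A : ℕ → ℕ → ℂ) : Prop :=
  ∀ k, Tendsto (fun n => hat α A n k) atTop (𝓝 0)

/-- `lim_n (∑_k â_{nk} - γ_n) = 0`. -/
def Cond6A (α : ℝ) (A : ℕ → ℕ → ℂ) (γ : ℕ → ℂ) : Prop :=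
  Tendsto (fun n => series (hat α A n) - γ n) atTop (𝓝 0)

/-- `lim_n â_{nk}` exists and equals `a_k`, for all `k`. -/
def Cond7A (α : ℝ) (A : ℕ → ℕ → ℂ) (a : ℕ → ℂ) : Prop :=
  ∀ k, Tendsto (fun n => hat α A n k) atTop (𝓝 (a k))

/-- `∑_k |â_{nk}| < ∞` for all `n`, and `∑_k |a_k| < ∞`. -/
def Cond7B (α : ℝ) (A : ℕ → ℕ → ℂ) (a : ℕ → ℂ) : Prop :=
  (∀ n, ∑' k, ‖hat α A n k‖ₑ < ∞) ∧ ∑' k, ‖a k‖ₑ < ∞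

/-- `lim_n ∑_k |â_{nk} - a_k| = 0`. -/
def Cond7C (α : ℝ) (A : ℕ → ℕ → ℂ) (a : ℕ → ℂ) : Prop :=
  Tendsto (fun n => ∑' k, ‖hat α A n k - a k‖ₑ) atTop (𝓝 0)

/-- `lim_n (∑_k â_{nk} - γ_n)` exists. -/
def Cond9A (α : ℝ) (A : ℕ → ℕ → ℂ) (γ : ℕ → ℂ) : Prop :=
  ∃ δ, Tendsto (fun n => series (hat α A n) - γ n) atTop (𝓝 δ)

/-- `sup_{K ⊆ ℕ} ∑_n |∑_{k ∈ K} â_{nk}| < ∞`, all the inner series being convergent. -/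
def Cond10A (α : ℝ) (A : ℕ → ℕ → ℂ) : Prop :=
  (∀ (K : Set ℕ) (n : ℕ), Converges (K.indicator (hat α A n))) ∧
    (⨆ K : Set ℕ, ∑' n, ‖series (K.indicator (hat α A n))‖ₑ) < ∞

/-- `∑_n |∑_k â_{nk} - γ_n| < ∞`. -/
def Cond12A (α : ℝ) (A : ℕ → ℕ → ℂ) (γ : ℕ → ℂ) : Prop :=
  ∑' n, ‖series (hat α A n) - γ n‖ₑ < ∞

end FracDiff

namespace FracDiff

/-! ### Absolutely summable sequences and their pairing with bounded sequences -/

/-! The operators Δ^(α) and Δ^(-α) are mutually inverse on all sequences (Vandermonde's identity),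
so `A` maps X(Δ^(α)) into Y iff, for every y in X, the series of a_{nk} (Δ^(-α) y)_k converge and
their sums form a sequence in Y (`mem_matClass_fracSpace`). Interchanging finite sums, the m-th
partial sum equals ∑_j t_{mj} y_j, where t_{mj} = `truncHat` is a partial sum of the series for
â_{nj}, and w_{mj} = â_{nj} - t_{mj} for j ≤ m.

For fixed n, convergence thus says that the finitely supported rows t_m pair convergently with each
y in X. Unit sequences force t_{mj} → â_{nj}. On null sequences, uniform boundedness makes this
equivalent to bounded ℓ₁ norms of t_m, which is summability of the row of Â plus 2A. On bounded
sequences, Schur's theorem (`exists_tendsto_tsum_norm_sub`, proved by Baire category) makes it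
equivalent to summability of the row plus t_m → â_n in ℓ₁ norm, which is 1B. In both cases the sum
of the series is ∑_k â_{nk} y_k.

What remains is the classical question when a matrix with absolutely summable rows maps c₀ or ℓ_∞
into Y, settled by the same two principles together with a duality argument for Y = ℓ₁. Convergent
sequences are null sequences plus multiples of the constant sequence 1, whose image is ∑_k â_{nk} -
γ_n; this accounts for 3A, 3B, 6A, 9A and 12A. -/

theorem exists_norm_le_one_mul_eq_norm (z : ℂ) : ∃ u : ℂ, ‖u‖ ≤ 1 ∧ z * u = ‖z‖ := by
  by_cases hz : z = 0
  · exact ⟨0, by simp, by simp [hz]⟩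
  · exact ⟨(‖z‖ : ℂ) / z, by simp [hz], by field_simp⟩

/-- Test against the conjugate phases of b on F. The test sequences are finitely supported, hence
null as well as bounded. -/
theorem sum_norm_le_of_forall_dual {b : ℕ → ℂ} {F : Finset ℕ} {C : ℝ}
    (h : ∀ y : ℕ → ℂ, (∀ k, ‖y k‖ ≤ 1) → (∀ k ∉ F, y k = 0) → ‖∑ k ∈ F, b k * y k‖ ≤ C) :
    ∑ k ∈ F, ‖b k‖ ≤ C := by
  classical
  choose u hu hbu using fun k => exists_norm_le_one_mul_eq_norm (b k)
  have key := h (fun k => if k ∈ F then u k else 0)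
    (fun k => by split_ifs <;> simp [hu k]) (fun k hk => by simp [hk])
  have e : ∑ k ∈ F, b k * (if k ∈ F then u k else 0) = ((∑ k ∈ F, ‖b k‖ : ℝ) : ℂ) := by
    push_cast
    exact Finset.sum_congr rfl fun k hk => by simp [hk, hbu]
  rw [e, Complex.norm_real, Real.norm_of_nonneg (Finset.sum_nonneg fun _ _ => norm_nonneg _)]
    at key
  exact key

theorem summable_norm_mul {b y : ℕ → ℂ} {M : ℝ} (hb : Summable fun k => ‖b k‖)
    (hy : ∀ k, ‖y k‖ ≤ M) : Summable fun k => ‖b k * y k‖ :=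
  Summable.of_nonneg_of_le (fun _ => norm_nonneg _)
    (fun k => by rw [norm_mul]; gcongr; exact hy k) (hb.mul_right M)

theorem norm_tsum_mul_le {b y : ℕ → ℂ} {M : ℝ} (hb : Summable fun k => ‖b k‖)
    (hy : ∀ k, ‖y k‖ ≤ M) : ‖∑' k, b k * y k‖ ≤ (∑' k, ‖b k‖) * M := by
  have h := summable_norm_mul hb hy
  refine (norm_tsum_le_tsum_norm h).trans ?_
  rw [← tsum_mul_right]
  exact h.tsum_le_tsum (fun k => by rw [norm_mul]; gcongr; exact hy k) (hb.mul_right M)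

theorem exists_norm_le_of_tendsto {y : ℕ → ℂ} {l : ℂ} (hy : Tendsto y atTop (𝓝 l)) :
    ∃ M, ∀ k, ‖y k‖ ≤ M := by
  obtain ⟨M, hM⟩ := hy.norm.bddAbove_range
  exact ⟨M, fun k => hM ⟨k, rfl⟩⟩

theorem tendsto_zero_of_forall_notMem {y : ℕ → ℂ} (F : Finset ℕ) (h : ∀ k ∉ F, y k = 0) :
    Tendsto y atTop (𝓝 0) := by
  rw [← Nat.cofinite_eq_atTop]
  refine tendsto_const_nhds.congr' ?_
  filter_upwards [F.finite_toSet.compl_mem_cofinite] with k hk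
  exact (h k (by simpa using hk)).symm

theorem tsum_mul_eq_sum {b y : ℕ → ℂ} {F : Finset ℕ} (h : ∀ k ∉ F, y k = 0) :
    ∑' k, b k * y k = ∑ k ∈ F, b k * y k :=
  tsum_eq_sum fun k hk => by simp [h k hk]

theorem summable_norm_of_forall_notMem {b : ℕ → ℂ} {F : Finset ℕ} (h : ∀ k ∉ F, b k = 0) :
    Summable fun k => ‖b k‖ :=
  summable_of_ne_finset_zero (s := F) fun k hk => by simp [h k hk]

/-! ### Uniform boundedness over the null sequences -/

/-- The functional on the null sequences given by an absolutely summable sequence. -/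
noncomputable def nullFunctional (b : ℕ → ℂ) (hb : Summable fun k => ‖b k‖) :
    ZeroAtInftyContinuousMap ℕ ℂ →L[ℂ] ℂ :=
  LinearMap.mkContinuous
    { toFun := fun y => ∑' k, b k * y k
      map_add' := fun y z => by
        have hn : ∀ (w : ZeroAtInftyContinuousMap ℕ ℂ), Summable fun k => b k * w k := fun w =>
          (summable_norm_mul hb fun k => w.toBCF.norm_coe_le_norm k).of_norm
        rw [← (hn y).tsum_add (hn z)]
        exact tsum_congr fun k => by simp [mul_add]
      map_smul' := fun c y => by
        simp only [RingHom.id_apply, smul_eq_mul, ← tsum_mul_left]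
        exact tsum_congr fun k => by simp [mul_left_comm] }
    (∑' k, ‖b k‖) fun y => norm_tsum_mul_le hb fun k => y.toBCF.norm_coe_le_norm k

/-- Banach–Steinhaus on c₀ bounds the functional norms; finitely supported vectors of the unit ball
recover the ℓ₁ norm from the functional norm. -/
theorem exists_tsum_norm_le_of_null {ι : Type*} {b : ι → ℕ → ℂ}
    (hb : ∀ i, Summable fun k => ‖b i k‖)
    (h : ∀ y : ℕ → ℂ, Tendsto y atTop (𝓝 0) → ∃ C, ∀ i, ‖∑' k, b i k * y k‖ ≤ C) :
    ∃ C, ∀ i, ∑' k, ‖b i k‖ ≤ C := by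
  have hnull : ∀ y : ZeroAtInftyContinuousMap ℕ ℂ, Tendsto y atTop (𝓝 0) := fun y => by
    have := y.zero_at_infty'
    rwa [cocompact_eq_cofinite, Nat.cofinite_eq_atTop] at this
  obtain ⟨C, hC⟩ := banach_steinhaus (g := fun i => nullFunctional (b i) (hb i))
    fun y => h y (hnull y)
  refine ⟨C, fun i => (hb i).tsum_le_of_sum_le fun F => sum_norm_le_of_forall_dual ?_⟩
  intro y hy hF
  let z : ZeroAtInftyContinuousMap ℕ ℂ :=
    { toFun := y
      continuous_toFun := continuous_of_discreteTopology
      zero_at_infty' := by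
        rw [cocompact_eq_cofinite, Nat.cofinite_eq_atTop]
        exact tendsto_zero_of_forall_notMem F hF }
  have hz : ‖z‖ ≤ 1 :=
    (BoundedContinuousFunction.norm_le (f := z.toBCF) zero_le_one).2 hy
  rw [← tsum_mul_eq_sum hF]
  calc ‖∑' k, b i k * y k‖ = ‖nullFunctional (b i) (hb i) z‖ := rfl
    _ ≤ ‖nullFunctional (b i) (hb i)‖ * 1 := ContinuousLinearMap.le_opNorm_of_le _ hz
    _ ≤ C := by rw [mul_one]; exact hC i

/-! ### Limits of pairings -/

theorem sum_norm_le_of_tendsto {b : ℕ → ℕ → ℂ} {a : ℕ → ℂ} {C : ℝ}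
    (hs : ∀ n, Summable fun k => ‖b n k‖) (hC : ∀ n, ∑' k, ‖b n k‖ ≤ C)
    (ha : ∀ k, Tendsto (fun n => b n k) atTop (𝓝 (a k))) (F : Finset ℕ) :
    ∑ k ∈ F, ‖a k‖ ≤ C :=
  le_of_tendsto (tendsto_finsetSum F fun k _ => (ha k).norm) (Eventually.of_forall fun n =>
    ((hs n).sum_le_tsum F fun _ _ => norm_nonneg _).trans (hC n))

theorem summable_norm_of_tendsto {b : ℕ → ℕ → ℂ} {a : ℕ → ℂ} {C : ℝ}
    (hs : ∀ n, Summable fun k => ‖b n k‖) (hC : ∀ n, ∑' k, ‖b n k‖ ≤ C)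
    (ha : ∀ k, Tendsto (fun n => b n k) atTop (𝓝 (a k))) : Summable fun k => ‖a k‖ :=
  summable_of_sum_le (fun _ => norm_nonneg _) (sum_norm_le_of_tendsto hs hC ha)

theorem tendsto_tsum_mul_zero {b : ℕ → ℕ → ℂ} {C : ℝ}
    (hs : ∀ n, Summable fun k => ‖b n k‖) (hC : ∀ n, ∑' k, ‖b n k‖ ≤ C)
    (hb : ∀ k, Tendsto (fun n => b n k) atTop (𝓝 0)) {y : ℕ → ℂ}
    (hy : Tendsto y atTop (𝓝 0)) :
    Tendsto (fun n => ∑' k, b n k * y k) atTop (𝓝 0) := by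
  have hC0 : 0 ≤ C := (tsum_nonneg fun _ => norm_nonneg _).trans (hC 0)
  obtain ⟨M, hM⟩ := exists_norm_le_of_tendsto hy
  rw [Metric.tendsto_atTop]
  intro ε hε
  -- Beyond p the tail costs at most C times this bound, less than ε/2; the summand 1 covers C = 0.
  obtain ⟨p, hp⟩ := Metric.tendsto_atTop.1 hy (ε / (2 * (C + 1))) (by positivity)
  have hhead : Tendsto (fun n => ∑ k ∈ Finset.range p, b n k * y k) atTop (𝓝 0) := by
    simpa using tendsto_finsetSum (Finset.range p) fun k _ => (hb k).mul_const (y k)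
  obtain ⟨N, hN⟩ := Metric.tendsto_atTop.1 hhead (ε / 2) (by positivity)
  refine ⟨N, fun n hn => ?_⟩
  have htail : ‖∑' k, b n (k + p) * y (k + p)‖ ≤ C * (ε / (2 * (C + 1))) := by
    have hs' := (summable_nat_add_iff p).2 (hs n)
    refine (norm_tsum_mul_le (b := fun k => b n (k + p)) hs' fun k => ?_).trans
      (mul_le_mul_of_nonneg_right ?_ (by positivity))
    · simpa using (hp (k + p) (by omega)).le
    · refine le_trans ?_ (hC n)
      rw [← (hs n).sum_add_tsum_nat_add p]
      exact le_add_of_nonneg_left (Finset.sum_nonneg fun _ _ => norm_nonneg _)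
  have hlt : C * (ε / (2 * (C + 1))) < ε / 2 := by
    rw [← mul_div_assoc, div_lt_div_iff₀ (by positivity) (by positivity)]
    nlinarith
  have := hN n hn
  rw [dist_zero_right] at this ⊢
  rw [← ((summable_norm_mul (hs n) hM).of_norm).sum_add_tsum_nat_add p]
  exact (norm_add_le _ _).trans_lt (by linarith)

/-- Subtracting the column limits reduces to null columns. The limits have ℓ₁ norm at most C, so the
differences have norm at most C + C. -/
theorem tendsto_tsum_mul_of_null {b : ℕ → ℕ → ℂ} {a : ℕ → ℂ} {C : ℝ}
    (hs : ∀ n, Summable fun k => ‖b n k‖) (hC : ∀ n, ∑' k, ‖b n k‖ ≤ C)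
    (ha : ∀ k, Tendsto (fun n => b n k) atTop (𝓝 (a k))) {y : ℕ → ℂ}
    (hy : Tendsto y atTop (𝓝 0)) :
    Tendsto (fun n => ∑' k, b n k * y k) atTop (𝓝 (∑' k, a k * y k)) := by
  have hsa := summable_norm_of_tendsto hs hC ha
  have hCa : ∑' k, ‖a k‖ ≤ C := hsa.tsum_le_of_sum_le (sum_norm_le_of_tendsto hs hC ha)
  obtain ⟨M, hM⟩ := exists_norm_le_of_tendsto hy
  have hle : ∀ n k, ‖b n k - a k‖ ≤ ‖b n k‖ + ‖a k‖ := fun n k => norm_sub_le _ _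
  have hsd : ∀ n, Summable fun k => ‖b n k - a k‖ := fun n =>
    Summable.of_nonneg_of_le (fun _ => norm_nonneg _) (hle n) ((hs n).add hsa)
  have key := tendsto_tsum_mul_zero (b := fun n k => b n k - a k) (C := C + C) hsd
    (fun n => ((hsd n).tsum_le_tsum (hle n) ((hs n).add hsa)).trans (by
      rw [(hs n).tsum_add hsa]; exact add_le_add (hC n) hCa))
    (fun k => by simpa using (ha k).sub_const (a k)) hy
  have e : ∀ n, ∑' k, (b n k - a k) * y k + ∑' k, a k * y k = ∑' k, b n k * y k := fun n => by
    rw [← (summable_norm_mul (hsd n) hM).of_norm.tsum_add (summable_norm_mul hsa hM).of_norm]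
    exact tsum_congr fun k => by ring
  simpa [e] using key.add_const (∑' k, a k * y k)

theorem tendsto_tsum_mul_of_bounded {b : ℕ → ℕ → ℂ} {a : ℕ → ℂ} {M : ℝ}
    (hs : ∀ n, Summable fun k => ‖b n k‖) (hsa : Summable fun k => ‖a k‖)
    (h : Tendsto (fun n => ∑' k, ‖b n k - a k‖) atTop (𝓝 0)) {y : ℕ → ℂ}
    (hM : ∀ k, ‖y k‖ ≤ M) :
    Tendsto (fun n => ∑' k, b n k * y k) atTop (𝓝 (∑' k, a k * y k)) := by
  have hsd : ∀ n, Summable fun k => ‖b n k - a k‖ := fun n =>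
    Summable.of_nonneg_of_le (fun _ => norm_nonneg _) (fun k => norm_sub_le _ _)
      ((hs n).add hsa)
  rw [tendsto_iff_norm_sub_tendsto_zero]
  refine squeeze_zero (fun _ => norm_nonneg _) (fun n => ?_) (by simpa using h.mul_const M)
  rw [← (summable_norm_mul (hs n) hM).of_norm.tsum_sub (summable_norm_mul hsa hM).of_norm]
  simp only [← sub_mul]
  exact norm_tsum_mul_le (hsd n) hM

/-! ### Weak and strong convergence of absolutely summable sequences -/

/-- Baire category on the product of closed unit discs, compact in the product topology. The closed
sets `S N` of points where the pairings are within ε of each other from N on cover the product, so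
one has interior; a basic open set constrains only the finite coordinate set I and leaves the others
free. -/
theorem exists_sum_norm_sub_le_of_cauchySeq {b : ℕ → ℕ → ℂ}
    (hs : ∀ n, Summable fun k => ‖b n k‖)
    (h : ∀ y : ℕ → ℂ, (∀ k, ‖y k‖ ≤ 1) → CauchySeq fun n => ∑' k, b n k * y k)
    {ε : ℝ} (hε : 0 < ε) :
    ∃ (I : Finset ℕ) (N : ℕ), ∀ m ≥ N, ∀ n ≥ N, ∀ G : Finset ℕ, Disjoint G I →
      ∑ k ∈ G, ‖b m k - b n k‖ ≤ 2 * ε := by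
  classical
  let X := ∀ _ : ℕ, Metric.closedBall (0 : ℂ) 1
  have : CompactSpace (Metric.closedBall (0 : ℂ) 1) :=
    isCompact_iff_compactSpace.1 (isCompact_closedBall _ _)
  have : Nonempty X := ⟨fun _ => ⟨0, by simp⟩⟩
  have hX : ∀ (y : X) k, ‖(y k : ℂ)‖ ≤ 1 := fun y k => mem_closedBall_zero_iff.1 (y k).2
  let φ : ℕ → X → ℂ := fun n y => ∑' k, b n k * y k
  have hφ : ∀ n, Continuous (φ n) := fun n =>
    continuous_tsum (fun k => by fun_prop) (hs n) fun k y => by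
      rw [norm_mul]; exact mul_le_of_le_one_right (norm_nonneg _) (hX y k)
  let S : ℕ → Set X := fun N => {y | ∀ m ≥ N, ∀ n ≥ N, ‖φ m y - φ n y‖ ≤ ε}
  have hclosed : ∀ N, IsClosed (S N) := fun N => by
    simp only [S, Set.ofPred_forall]
    exact isClosed_iInter fun m => isClosed_iInter fun _ => isClosed_iInter fun n =>
      isClosed_iInter fun _ => isClosed_le ((hφ m).sub (hφ n)).norm continuous_const
  have hunion : ⋃ N, S N = Set.univ := by
    refine Set.eq_univ_of_forall fun y => Set.mem_iUnion.2 ?_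
    obtain ⟨N, hN⟩ := Metric.cauchySeq_iff.1 (h (fun k => y k) (hX y)) ε hε
    exact ⟨N, fun m hm n hn => by simpa [dist_eq_norm] using (hN m hm n hn).le⟩
  obtain ⟨N, y₀, hy₀⟩ := nonempty_interior_of_iUnion_of_closed hclosed hunion
  obtain ⟨I, u, hu, hI⟩ := isOpen_pi_iff.1 isOpen_interior y₀ hy₀
  refine ⟨I, N, fun m hm n hn G hG => sum_norm_le_of_forall_dual fun y hy hyG => ?_⟩
  have hmem : ∀ z : X, (∀ k ∈ I, z k = y₀ k) → ‖φ m z - φ n z‖ ≤ ε := fun z hz =>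
    (interior_subset (hI fun k hk => by rw [hz k hk]; exact (hu k hk).2) : z ∈ S N) m hm n hn
  -- Both points agree with y₀ on I, hence lie in `S N`; their difference is y, which is supported
  -- in G. Each point contributes one ε.
  let z₁ : X := fun k => if k ∈ I then y₀ k else ⟨y k, by simpa using hy k⟩
  let z₂ : X := fun k => if k ∈ I then y₀ k else ⟨0, by simp⟩
  have h₁ := hmem z₁ fun k hk => by simp [z₁, hk]
  have h₂ := hmem z₂ fun k hk => by simp [z₂, hk]
  have hsum : ∀ n (z : X), Summable fun k => b n k * z k := fun n z =>
    (summable_norm_mul (hs n) (hX z)).of_norm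
  have hdiff : ∀ n, φ n z₁ - φ n z₂ = ∑ k ∈ G, b n k * y k := fun n => by
    rw [← tsum_mul_eq_sum hyG, ← (hsum n z₁).tsum_sub (hsum n z₂)]
    refine tsum_congr fun k => ?_
    by_cases hk : k ∈ I
    · have : y k = 0 := hyG k fun hkG => Finset.disjoint_left.1 hG hkG hk
      simp [z₁, z₂, hk, this]
    · simp [z₁, z₂, hk]
  have e : ∑ k ∈ G, (b m k - b n k) * y k = (φ m z₁ - φ n z₁) - (φ m z₂ - φ n z₂) := by
    simp only [sub_mul, Finset.sum_sub_distrib, ← hdiff]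
    ring
  rw [e]
  exact (norm_sub_le _ _).trans (by linarith)

/-- A weakly Cauchy sequence of absolutely summable sequences converges in norm. -/
theorem exists_tendsto_tsum_norm_sub {b : ℕ → ℕ → ℂ}
    (hs : ∀ n, Summable fun k => ‖b n k‖)
    (h : ∀ y : ℕ → ℂ, (∀ k, ‖y k‖ ≤ 1) → CauchySeq fun n => ∑' k, b n k * y k) :
    ∃ a : ℕ → ℂ, (∀ k, Tendsto (fun n => b n k) atTop (𝓝 (a k))) ∧
      (Summable fun k => ‖a k‖) ∧ Tendsto (fun n => ∑' k, ‖b n k - a k‖) atTop (𝓝 0) := by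
  classical
  have hcol : ∀ k, ∃ l, Tendsto (fun n => b n k) atTop (𝓝 l) := fun k => by
    refine cauchySeq_tendsto_of_complete ?_
    have := h (Pi.single k 1) fun j => by
      by_cases hj : j = k
      · subst hj; simp
      · simp [hj]
    simpa [Pi.single_apply] using this
  choose a ha using hcol
  have key : ∀ ε > 0, ∃ N, ∀ n ≥ N, ∀ G : Finset ℕ, ∑ k ∈ G, ‖b n k - a k‖ ≤ ε := by
    intro ε hε
    obtain ⟨I, N, hN⟩ := exists_sum_norm_sub_le_of_cauchySeq hs h (show 0 < ε / 4 by positivity)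
    have hI : Tendsto (fun n => ∑ k ∈ I, ‖b n k - a k‖) atTop (𝓝 0) := by
      simpa using tendsto_finsetSum I fun k _ => ((ha k).sub_const (a k)).norm
    obtain ⟨N', hN'⟩ := eventually_atTop.1 (hI.eventually_le_const (show 0 < ε / 2 by positivity))
    refine ⟨max N N', fun n hn G => ?_⟩
    -- Off I, let the other index m tend to infinity in the uniform estimate; on I, finitely many
    -- convergent columns suffice.
    have h₁ : ∑ k ∈ G \ I, ‖b n k - a k‖ ≤ 2 * (ε / 4) := by
      refine le_of_tendsto (tendsto_finsetSum (G \ I) fun k _ => ((ha k).const_sub (b n k)).norm)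
        (eventually_atTop.2 ⟨N, fun m hm => ?_⟩)
      exact hN n (le_of_max_le_left hn) m hm _ Finset.sdiff_disjoint
    have h₂ : ∑ k ∈ G ∩ I, ‖b n k - a k‖ ≤ ε / 2 :=
      (Finset.sum_le_sum_of_subset_of_nonneg Finset.inter_subset_right
        fun _ _ _ => norm_nonneg _).trans (hN' n (le_of_max_le_right hn))
    rw [← Finset.sum_inter_add_sum_sdiff G I]
    linarith
  have hsd : ∃ n, Summable fun k => ‖b n k - a k‖ := by
    obtain ⟨N, hN⟩ := key 1 one_pos
    exact ⟨N, summable_of_sum_le (fun _ => norm_nonneg _) (hN N le_rfl)⟩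
  obtain ⟨p, hp⟩ := hsd
  have hsa : Summable fun k => ‖a k‖ :=
    Summable.of_nonneg_of_le (fun _ => norm_nonneg _)
      (fun k => by simpa using norm_sub_le (b p k) (b p k - a k)) ((hs p).add hp)
  refine ⟨a, ha, hsa, ?_⟩
  rw [Metric.tendsto_atTop]
  intro ε hε
  obtain ⟨N, hN⟩ := key (ε / 2) (by positivity)
  refine ⟨N, fun n hn => ?_⟩
  rw [Real.dist_0_eq_abs, abs_of_nonneg (tsum_nonneg fun _ => norm_nonneg _)]
  exact (tsum_le_of_sum_le' (by positivity) (hN n hn)).trans_lt (by linarith)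

/-! ### Matrices into the absolutely summable sequences -/

/-- Split into real and imaginary parts and then by sign: each of the four pieces is bounded by a
subset sum, at cost C. -/
theorem sum_norm_le_four_mul {c : ℕ → ℂ} {C : ℝ} (h : ∀ F : Finset ℕ, ‖∑ k ∈ F, c k‖ ≤ C)
    (F : Finset ℕ) : ∑ k ∈ F, ‖c k‖ ≤ 4 * C := by
  have hreal : ∀ f : ℕ → ℝ, (∀ F : Finset ℕ, |∑ k ∈ F, f k| ≤ C) → ∑ k ∈ F, |f k| ≤ 2 * C := by
    intro f hf
    rw [← Finset.sum_filter_add_sum_filter_not F (fun k => 0 ≤ f k)]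
    have h₁ : ∑ k ∈ F with 0 ≤ f k, |f k| = ∑ k ∈ F with 0 ≤ f k, f k :=
      Finset.sum_congr rfl fun k hk => abs_of_nonneg (Finset.mem_filter.1 hk).2
    have h₂ : ∑ k ∈ F with ¬ 0 ≤ f k, |f k| = -∑ k ∈ F with ¬ 0 ≤ f k, f k := by
      rw [← Finset.sum_neg_distrib]
      exact Finset.sum_congr rfl fun k hk =>
        abs_of_neg (not_le.1 (Finset.mem_filter.1 hk).2)
    have h₃ := (abs_le.1 (hf {k ∈ F | 0 ≤ f k})).2
    have h₄ := (abs_le.1 (hf {k ∈ F | ¬ 0 ≤ f k})).1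
    linarith
  have hre := hreal (fun k => (c k).re) fun G => by
    simpa using (Complex.abs_re_le_norm _).trans (h G)
  have him := hreal (fun k => (c k).im) fun G => by
    simpa using (Complex.abs_im_le_norm _).trans (h G)
  refine (Finset.sum_le_sum fun k _ => Complex.norm_le_abs_re_add_abs_im (c k)).trans ?_
  rw [Finset.sum_add_distrib]
  linarith

theorem sum_tsum_mul_mul {B : ℕ → ℕ → ℂ} (hs : ∀ n, Summable fun k => ‖B n k‖) {y : ℕ → ℂ}
    {M : ℝ} (hM : ∀ k, ‖y k‖ ≤ M) (N : Finset ℕ) (u : ℕ → ℂ) :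
    ∑ n ∈ N, (∑' k, B n k * y k) * u n = ∑' k, (∑ n ∈ N, B n k * u n) * y k := by
  simp only [Finset.sum_mul]
  rw [Summable.tsum_finsetSum fun n _ => ?_]
  · refine Finset.sum_congr rfl fun n _ => ?_
    rw [← tsum_mul_right]
    exact tsum_congr fun k => by ring
  · refine ((summable_norm_mul (hs n) hM).of_norm.mul_right (u n)).congr fun k => by ring

theorem summable_norm_sum_mul {B : ℕ → ℕ → ℂ} (hs : ∀ n, Summable fun k => ‖B n k‖)
    (N : Finset ℕ) (u : ℕ → ℂ) : Summable fun k => ‖∑ n ∈ N, B n k * u n‖ := by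
  refine Summable.of_nonneg_of_le (fun _ => norm_nonneg _) (fun k => norm_sum_le _ _)
    (summable_sum fun n _ => ?_)
  simpa only [norm_mul] using (hs n).mul_right ‖u n‖

/-- Uniform boundedness over c₀ is applied to all combinations ∑_{n ∈ N} u_n B_n with N finite and
|u_n| ≤ 1. It yields an ℓ₁ bound on these rows, which controls every y in the unit ball of ℓ_∞, not
only null ones. -/
theorem exists_sum_norm_tsum_mul_le {B : ℕ → ℕ → ℂ} (hs : ∀ n, Summable fun k => ‖B n k‖)
    (h : ∀ y : ℕ → ℂ, Tendsto y atTop (𝓝 0) → Summable fun n => ‖∑' k, B n k * y k‖) :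
    ∃ C, ∀ (y : ℕ → ℂ), (∀ k, ‖y k‖ ≤ 1) → ∀ N : Finset ℕ,
      ∑ n ∈ N, ‖∑' k, B n k * y k‖ ≤ C := by
  obtain ⟨C, hC⟩ := exists_tsum_norm_le_of_null
    (ι := Finset ℕ × {u : ℕ → ℂ // ∀ n, ‖u n‖ ≤ 1})
    (b := fun i k => ∑ n ∈ i.1, B n k * i.2.1 n)
    (fun i => summable_norm_sum_mul hs i.1 i.2.1) (fun y hy => by
      obtain ⟨M, hM⟩ := exists_norm_le_of_tendsto hy
      refine ⟨∑' n, ‖∑' k, B n k * y k‖, fun i => ?_⟩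
      rw [← sum_tsum_mul_mul hs hM]
      refine (norm_sum_le _ _).trans (le_trans (Finset.sum_le_sum fun n _ => ?_)
        ((h y hy).sum_le_tsum i.1 fun _ _ => norm_nonneg _))
      rw [norm_mul]
      exact mul_le_of_le_one_right (norm_nonneg _) (i.2.2 n))
  refine ⟨C, fun y hy N => sum_norm_le_of_forall_dual fun u hu _ => ?_⟩
  rw [sum_tsum_mul_mul hs hy]
  refine (norm_tsum_mul_le (summable_norm_sum_mul hs N u) hy).trans ?_
  rw [mul_one]
  exact hC (N, ⟨u, hu⟩)

/-- Dualize in n with |u_n| ≤ 1. Subset sums of the combined row ∑_n u_n B_n are at most C by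
hypothesis, so its ℓ₁ norm is at most 4C; pairing with y gives the factor M. -/
theorem summable_norm_tsum_mul_of_indicator {B : ℕ → ℕ → ℂ}
    (hs : ∀ n, Summable fun k => ‖B n k‖) {C : ℝ}
    (h : ∀ K N : Finset ℕ, ∑ n ∈ N, ‖∑ k ∈ K, B n k‖ ≤ C) {y : ℕ → ℂ} {M : ℝ}
    (hM : ∀ k, ‖y k‖ ≤ M) : Summable fun n => ‖∑' k, B n k * y k‖ := by
  have hM0 : 0 ≤ M := (norm_nonneg _).trans (hM 0)
  refine summable_of_sum_le (c := 4 * C * M) (fun _ => norm_nonneg _) fun N =>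
    sum_norm_le_of_forall_dual fun u hu _ => ?_
  rw [sum_tsum_mul_mul hs hM]
  have hsum := summable_norm_sum_mul hs N u
  refine (norm_tsum_mul_le hsum hM).trans (mul_le_mul_of_nonneg_right
    (hsum.tsum_le_of_sum_le (sum_norm_le_four_mul fun F => ?_)) hM0)
  rw [Finset.sum_comm]
  simp only [← Finset.sum_mul]
  refine (norm_sum_le _ _).trans (le_trans (Finset.sum_le_sum fun n _ => ?_) (h F N))
  rw [norm_mul]
  exact mul_le_of_le_one_right (norm_nonneg _) (hu n)

/-! ### Inversion of the fractional difference -/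

/-- Vandermonde convolution for β + (-β) = 0; the signs combine to (-1)^n. -/
theorem sum_antidiagonal_coeff_mul_coeff_neg (β : ℝ) (n : ℕ) :
    ∑ p ∈ Finset.HasAntidiagonal.antidiagonal n, coeff β p.1 * coeff (-β) p.2 = if n = 0 then 1 else 0 := by
  have h := Ring.add_choose_eq n (Commute.all β (-β))
  rw [add_neg_cancel, Ring.choose_zero_ite] at h
  have e : ∀ p ∈ Finset.HasAntidiagonal.antidiagonal n, coeff β p.1 * coeff (-β) p.2
      = (-1) ^ n * (Ring.choose β p.1 * Ring.choose (-β) p.2) := fun p hp => by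
    rw [coeff, coeff, ← Finset.HasAntidiagonal.mem_antidiagonal.1 hp, pow_add]
    ring
  rw [Finset.sum_congr rfl e, ← Finset.mul_sum, ← h]
  split_ifs with hn <;> simp [hn]

/-- The generating series of the coefficients. -/
noncomputable def genSeries (β : ℝ) : PowerSeries ℂ := PowerSeries.mk fun i => (coeff β i : ℂ)

theorem genSeries_mul_neg (β : ℝ) : genSeries β * genSeries (-β) = 1 := by
  ext n
  have h := congrArg (fun r : ℝ => (r : ℂ)) (sum_antidiagonal_coeff_mul_coeff_neg β n)
  simp only [Complex.ofReal_sum, Complex.ofReal_mul] at h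
  rw [PowerSeries.coeff_mul, PowerSeries.coeff_one]
  simp only [genSeries, PowerSeries.coeff_mk, h]
  split_ifs <;> simp

theorem mk_fracDiff (β : ℝ) (x : ℕ → ℂ) :
    PowerSeries.mk (fracDiff β x) = genSeries β * PowerSeries.mk x := by
  ext n
  rw [PowerSeries.coeff_mul]
  simp only [genSeries, PowerSeries.coeff_mk]
  rw [Finset.Nat.sum_antidiagonal_eq_sum_range_succ (fun i j => (coeff β i : ℂ) * x j)]
  rfl

theorem fracDiff_fracDiff_neg (β : ℝ) (x : ℕ → ℂ) : fracDiff β (fracDiff (-β) x) = x := by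
  have h : PowerSeries.mk (fracDiff β (fracDiff (-β) x)) = PowerSeries.mk x := by
    rw [mk_fracDiff, mk_fracDiff, ← mul_assoc, genSeries_mul_neg, one_mul]
  funext n
  simpa using congrArg (PowerSeries.coeff n) h

/-- Substitute x = Δ^(-α) y, a bijection from X onto X(Δ^(α)). -/
theorem mem_matClass_fracSpace {α : ℝ} {A : ℕ → ℕ → ℂ} {X Y : Set (ℕ → ℂ)} :
    A ∈ MatClass (fracSpace X α) Y ↔ ∀ y ∈ X,
      (∀ n, Converges fun k => A n k * fracDiff (-α) y k) ∧
        (fun n => series fun k => A n k * fracDiff (-α) y k) ∈ Y := by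
  constructor
  · intro h y hy
    refine h _ ?_
    simpa [fracSpace, fracDiff_fracDiff_neg] using hy
  · intro h x hx
    have := h (fracDiff α x) hx
    have e : fracDiff (-α) (fracDiff α x) = x := by
      simpa using fracDiff_fracDiff_neg (-α) x
    rwa [e] at this

/-! ### Partial sums of the transformed series -/

/-- The partial sums of the series defining `hat`, summed over the columns below `m`. -/
noncomputable def truncHat (α : ℝ) (A : ℕ → ℕ → ℂ) (n m j : ℕ) : ℂ :=
  ∑ i ∈ Finset.range (m - j), (coeff (-α) i : ℂ) * A n (j + i)

variable {α : ℝ} {A : ℕ → ℕ → ℂ}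

theorem truncHat_of_le {n m j : ℕ} (h : m ≤ j) : truncHat α A n m j = 0 := by
  simp [truncHat, Nat.sub_eq_zero_of_le h]

theorem truncHat_of_notMem {n m : ℕ} : ∀ j ∉ Finset.range m, truncHat α A n m j = 0 :=
  fun _ hj => truncHat_of_le (by simpa using hj)

theorem summable_norm_truncHat (n m : ℕ) : Summable fun j => ‖truncHat α A n m j‖ :=
  summable_norm_of_forall_notMem truncHat_of_notMem

theorem sum_range_mul_fracDiff (n m : ℕ) (y : ℕ → ℂ) :
    ∑ k ∈ Finset.range m, A n k * fracDiff (-α) y k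
      = ∑ j ∈ Finset.range m, truncHat α A n m j * y j := by
  induction m with
  | zero => simp
  | succ m ih =>
    -- Raising m by one adds to column j exactly the term i = m - j; for j = m the old truncation is
    -- empty.
    have e : ∀ j ∈ Finset.range (m + 1), truncHat α A n (m + 1) j * y j
        = truncHat α A n m j * y j + A n m * ((coeff (-α) (m - j) : ℂ) * y j) := by
      intro j hj
      have hj : j ≤ m := by simpa [Nat.lt_succ_iff] using hj
      rw [truncHat, truncHat, Nat.succ_sub hj, Finset.sum_range_succ, Nat.add_sub_cancel' hj]
      ring
    rw [Finset.sum_range_succ, ih, Finset.sum_congr rfl e, Finset.sum_add_distrib,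
      Finset.sum_range_succ (fun j => truncHat α A n m j * y j), truncHat_of_le le_rfl,
      ← Finset.mul_sum, fracDiff,
      ← Finset.sum_flip fun i => (coeff (-α) i : ℂ) * y (m - i)]
    have e' : ∀ j ∈ Finset.range (m + 1), (coeff (-α) (m - j) : ℂ) * y (m - (m - j))
        = (coeff (-α) (m - j) : ℂ) * y j := fun j hj => by
      rw [Nat.sub_sub_self (by simpa [Nat.lt_succ_iff] using hj)]
    rw [Finset.sum_congr rfl e']
    ring

theorem sum_range_mul_fracDiff_eq_tsum (n m : ℕ) (y : ℕ → ℂ) :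
    ∑ k ∈ Finset.range m, A n k * fracDiff (-α) y k = ∑' j, truncHat α A n m j * y j := by
  rw [sum_range_mul_fracDiff]
  exact (tsum_eq_sum fun j hj => by simp [truncHat_of_notMem j hj]).symm

theorem converges_mul_fracDiff_iff {n : ℕ} {y : ℕ → ℂ} :
    (Converges fun k => A n k * fracDiff (-α) y k) ↔
      ∃ s, Tendsto (fun m => ∑' j, truncHat α A n m j * y j) atTop (𝓝 s) := by
  simp only [converges_iff, sum_range_mul_fracDiff_eq_tsum]

theorem series_mul_fracDiff {n : ℕ} {y : ℕ → ℂ} {s : ℂ}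
    (h : Tendsto (fun m => ∑' j, truncHat α A n m j * y j) atTop (𝓝 s)) :
    (series fun k => A n k * fracDiff (-α) y k) = s :=
  series_eq (by simpa only [sum_range_mul_fracDiff_eq_tsum] using h)

theorem Converges.tendsto {f : ℕ → ℂ} (h : Converges f) :
    Tendsto (fun N => ∑ k ∈ Finset.range N, f k) atTop (𝓝 (series f)) := by
  obtain ⟨s, hs⟩ := (converges_iff f).1 h
  rwa [series_eq hs]

theorem series_eq_tsum {f : ℕ → ℂ} (hf : Summable fun k => ‖f k‖) : series f = ∑' k, f k :=
  series_eq hf.of_norm.hasSum.tendsto_sum_nat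

theorem tendsto_truncHat (h : HatDefined α A) (n j : ℕ) :
    Tendsto (fun m => truncHat α A n m j) atTop (𝓝 (hat α A n j)) :=
  (h n j).tendsto.comp (tendsto_sub_atTop_nat j)

theorem hatDefined_of_forall_single
    (h : ∀ n j, Converges fun k => A n k * fracDiff (-α) (Pi.single j 1) k) :
    HatDefined α A := by
  intro n j
  obtain ⟨s, hs⟩ := converges_mul_fracDiff_iff.1 (h n j)
  -- Column j of the truncation at m + j has exactly m terms.
  refine (converges_iff _).2 ⟨s, ((tendsto_add_atTop_iff_nat j).2 hs).congr fun m => ?_⟩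
  simp [Pi.single_apply, truncHat]

/-- For k ≤ m, w_{mk} is the tail of the series for â_{nk} after its first m - k terms. -/
theorem wMat_eq (h : HatDefined α A) {n m k : ℕ} (hk : k ≤ m) :
    wMat α A n m k = hat α A n k - truncHat α A n m k := by
  rw [wMat, if_pos hk]
  refine series_eq ?_
  have := ((tendsto_add_atTop_iff_nat (m - k)).2 (h n k).tendsto).sub_const (truncHat α A n m k)
  refine this.congr fun N => ?_
  rw [add_comm N, Finset.sum_range_add, truncHat, add_sub_cancel_left]
  refine Finset.sum_congr rfl fun i _ => ?_
  rw [show m - k + i = m + i - k by omega, show k + (m + i - k) = m + i by omega]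

theorem sum_norm_wMat_eq (h : HatDefined α A) (n m : ℕ) :
    ∑ k ∈ Finset.range (m + 1), ‖wMat α A n m k‖
      = ∑ k ∈ Finset.range (m + 1), ‖truncHat α A n m k - hat α A n k‖ :=
  Finset.sum_congr rfl fun k hk => by
    rw [wMat_eq h (by simpa [Nat.lt_succ_iff] using hk), norm_sub_rev]

/-- The two sums differ only in the columns k > m, where the truncation vanishes and a tail of the
summable row of Â remains. -/
theorem tendsto_sum_norm_wMat_iff (h : HatDefined α A) {n : ℕ}
    (hs : Summable fun k => ‖hat α A n k‖) :
    Tendsto (fun m => ∑ k ∈ Finset.range (m + 1), ‖wMat α A n m k‖) atTop (𝓝 0) ↔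
      Tendsto (fun m => ∑' k, ‖truncHat α A n m k - hat α A n k‖) atTop (𝓝 0) := by
  have ht : Tendsto (fun m => ∑' k, ‖hat α A n (k + (m + 1))‖) atTop (𝓝 0) :=
    (tendsto_add_atTop_iff_nat 1).2 (tendsto_sum_nat_add fun k => ‖hat α A n k‖)
  have e : ∀ m, ∑' k, ‖truncHat α A n m k - hat α A n k‖
      = ∑ k ∈ Finset.range (m + 1), ‖wMat α A n m k‖ + ∑' k, ‖hat α A n (k + (m + 1))‖ := by
    intro m
    have hsd : Summable fun k => ‖truncHat α A n m k - hat α A n k‖ :=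
      Summable.of_nonneg_of_le (fun _ => norm_nonneg _) (fun k => norm_sub_le _ _)
        ((summable_norm_truncHat n m).add hs)
    rw [sum_norm_wMat_eq h, ← hsd.sum_add_tsum_nat_add (m + 1)]
    congr 1
    exact tsum_congr fun k => by rw [truncHat_of_le (by omega), zero_sub, norm_neg]
  simp only [e]
  constructor
  · intro h'
    simpa using h'.add ht
  · intro h'
    simpa using h'.sub ht

/-! ### Finiteness conditions in `[0, ∞]` -/

theorem iSup_ofReal_lt_top_iff {ι : Type*} {g : ι → ℝ} :
    (⨆ i, ENNReal.ofReal (g i)) < ∞ ↔ ∃ C, ∀ i, g i ≤ C := by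
  constructor
  · intro h
    refine ⟨(⨆ i, ENNReal.ofReal (g i)).toReal, fun i => ?_⟩
    exact (ENNReal.ofReal_le_iff_le_toReal h.ne).1 (le_iSup (fun i => ENNReal.ofReal (g i)) i)
  · rintro ⟨C, hC⟩
    exact (iSup_le fun i => ENNReal.ofReal_le_ofReal (hC i)).trans_lt ENNReal.ofReal_lt_top

theorem tsum_enorm_eq_ofReal {f : ℕ → ℂ} (hf : Summable fun k => ‖f k‖) :
    ∑' k, ‖f k‖ₑ = ENNReal.ofReal (∑' k, ‖f k‖) := by
  rw [ENNReal.ofReal_tsum_of_nonneg (fun _ => norm_nonneg _) hf]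
  simp only [ofReal_norm]

theorem tsum_enorm_lt_top_iff {f : ℕ → ℂ} : ∑' k, ‖f k‖ₑ < ∞ ↔ Summable fun k => ‖f k‖ :=
  lt_top_iff_ne_top.trans tsum_enorm_ne_top_iff_summable_norm

theorem summable_norm_of_iSup_lt_top {ι : Type*} {f : ι → ℕ → ℂ}
    (h : (⨆ i, ∑' k, ‖f i k‖ₑ) < ∞) (i : ι) : Summable fun k => ‖f i k‖ :=
  tsum_enorm_lt_top_iff.1 ((le_iSup (fun i => ∑' k, ‖f i k‖ₑ) i).trans_lt h)

theorem iSup_tsum_enorm_lt_top_iff {ι : Type*} {f : ι → ℕ → ℂ}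
    (hf : ∀ i, Summable fun k => ‖f i k‖) :
    (⨆ i, ∑' k, ‖f i k‖ₑ) < ∞ ↔ ∃ C, ∀ i, ∑' k, ‖f i k‖ ≤ C := by
  simp only [tsum_enorm_eq_ofReal (hf _), iSup_ofReal_lt_top_iff]

theorem tendsto_tsum_enorm_iff {f : ℕ → ℕ → ℂ} (hf : ∀ n, Summable fun k => ‖f n k‖) :
    Tendsto (fun n => ∑' k, ‖f n k‖ₑ) atTop (𝓝 0) ↔
      Tendsto (fun n => ∑' k, ‖f n k‖) atTop (𝓝 0) := by
  simp only [tsum_enorm_eq_ofReal (hf _)]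
  constructor
  · intro h
    simpa [Function.comp_def, ENNReal.toReal_ofReal (tsum_nonneg fun _ => norm_nonneg _)] using
      (ENNReal.tendsto_toReal ENNReal.zero_ne_top).comp h
  · intro h
    simpa using ENNReal.tendsto_ofReal h

theorem cond2A_iff : Cond2A α A ↔
    ∀ n, ∃ C, ∀ m, ∑ k ∈ Finset.range (m + 1), ‖wMat α A n m k‖ ≤ C := by
  refine forall_congr' fun n => ?_
  rw [← iSup_ofReal_lt_top_iff]
  simp only [ENNReal.ofReal_sum_of_nonneg fun _ _ => norm_nonneg _, ofReal_norm]

theorem mem_ellInf_iff {z : ℕ → ℂ} : z ∈ ellInf ↔ ∃ C, ∀ n, ‖z n‖ ≤ C := by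
  simp [ellInf, bddAbove_def]

theorem mem_ellInf_iff_iSup {z : ℕ → ℂ} : z ∈ ellInf ↔ (⨆ n, ‖z n‖ₑ) < ∞ := by
  simp only [mem_ellInf_iff, ← ofReal_norm, iSup_ofReal_lt_top_iff]

theorem mem_ellOne_iff {z : ℕ → ℂ} : z ∈ ellOne ↔ ∑' n, ‖z n‖ₑ < ∞ :=
  tsum_enorm_lt_top_iff.symm

/-! ### Reduction to the matrix `hat` -/

theorem single_mem_cZero (j : ℕ) : (Pi.single j 1 : ℕ → ℂ) ∈ cZero :=
  tendsto_zero_of_forall_notMem {j} fun k hk => by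
    simpa using Pi.single_eq_of_ne (by simpa using hk) _

theorem cZero_subset_cConv : cZero ⊆ cConv := fun _ hy => ⟨0, hy⟩

theorem cZero_subset_ellInf : cZero ⊆ ellInf := fun _ hy =>
  mem_ellInf_iff.2 (exists_norm_le_of_tendsto hy)

/-- A uniform ℓ₁ bound passes to the columnwise limit â_n; after that, t_m and w_m differ by a fixed
summable row. -/
theorem exists_tsum_norm_truncHat_le_iff (h : HatDefined α A) (n : ℕ) :
    (∃ C, ∀ m, ∑' k, ‖truncHat α A n m k‖ ≤ C) ↔
      (Summable fun k => ‖hat α A n k‖) ∧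
        ∃ C, ∀ m, ∑ k ∈ Finset.range (m + 1), ‖wMat α A n m k‖ ≤ C := by
  constructor
  · rintro ⟨C, hC⟩
    have hs := summable_norm_of_tendsto (summable_norm_truncHat n) hC (tendsto_truncHat h n)
    refine ⟨hs, C + ∑' k, ‖hat α A n k‖, fun m => ?_⟩
    rw [sum_norm_wMat_eq h]
    refine (Finset.sum_le_sum fun k _ => norm_sub_le _ _).trans ?_
    rw [Finset.sum_add_distrib]
    exact add_le_add
      (((summable_norm_truncHat n m).sum_le_tsum _ fun _ _ => norm_nonneg _).trans (hC m))
      (hs.sum_le_tsum _ fun _ _ => norm_nonneg _)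
  · rintro ⟨hs, C, hC⟩
    refine ⟨C + ∑' k, ‖hat α A n k‖, fun m => ?_⟩
    have e : ∑' k, ‖truncHat α A n m k‖ = ∑ k ∈ Finset.range (m + 1), ‖truncHat α A n m k‖ :=
      tsum_eq_sum fun k hk => by
        rw [truncHat_of_le (by simp at hk; omega), norm_zero]
    rw [e]
    have hle : ∀ k ∈ Finset.range (m + 1), ‖truncHat α A n m k‖
        ≤ ‖truncHat α A n m k - hat α A n k‖ + ‖hat α A n k‖ := fun k _ => by
      simpa using norm_add_le (truncHat α A n m k - hat α A n k) (hat α A n k)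
    refine (Finset.sum_le_sum hle).trans ?_
    rw [Finset.sum_add_distrib, ← sum_norm_wMat_eq h]
    exact add_le_add (hC m) (hs.sum_le_tsum _ fun _ _ => norm_nonneg _)

theorem tendsto_of_cond2A (h : HatDefined α A) (hs : ∀ n, Summable fun k => ‖hat α A n k‖)
    (h2 : Cond2A α A) {y : ℕ → ℂ} (hy : y ∈ cZero) (n : ℕ) :
    Tendsto (fun m => ∑' j, truncHat α A n m j * y j) atTop (𝓝 (∑' j, hat α A n j * y j)) := by
  obtain ⟨C, hC⟩ := (exists_tsum_norm_truncHat_le_iff h n).2 ⟨hs n, cond2A_iff.1 h2 n⟩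
  exact tendsto_tsum_mul_of_null (summable_norm_truncHat n) hC (tendsto_truncHat h n) hy

/-- Separates the existence of the series, handled row by row through uniform boundedness, from the
mapping property of Â into Y. -/
theorem mem_matClass_cZero_iff {Y : Set (ℕ → ℂ)} :
    A ∈ MatClass (fracSpace cZero α) Y ↔
      HatDefined α A ∧ (∀ n, Summable fun k => ‖hat α A n k‖) ∧ Cond2A α A ∧
        ∀ y ∈ cZero, (fun n => ∑' k, hat α A n k * y k) ∈ Y := by
  rw [mem_matClass_fracSpace]
  constructor
  · intro h
    have hd : HatDefined α A :=
      hatDefined_of_forall_single fun n j => (h _ (single_mem_cZero j)).1 n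
    have hb := fun n => (exists_tsum_norm_truncHat_le_iff hd n).1 <|
      exists_tsum_norm_le_of_null (summable_norm_truncHat n) fun y hy => by
        obtain ⟨s, hs⟩ := converges_mul_fracDiff_iff.1 ((h y hy).1 n)
        exact exists_norm_le_of_tendsto hs
    have h2 : Cond2A α A := cond2A_iff.2 fun n => (hb n).2
    refine ⟨hd, fun n => (hb n).1, h2, fun y hy => ?_⟩
    convert (h y hy).2 using 2 with n
    exact (series_mul_fracDiff (tendsto_of_cond2A hd (fun n => (hb n).1) h2 hy n)).symm
  · rintro ⟨hd, hs, h2, hY⟩ y hy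
    have ht := tendsto_of_cond2A hd hs h2 hy
    refine ⟨fun n => converges_mul_fracDiff_iff.2 ⟨_, ht n⟩, ?_⟩
    simpa only [series_mul_fracDiff (ht _)] using hY y hy

theorem tendsto_of_cond1B (h : HatDefined α A) (hs : ∀ n, Summable fun k => ‖hat α A n k‖)
    (h1 : Cond1B α A) {y : ℕ → ℂ} (hy : y ∈ ellInf) (n : ℕ) :
    Tendsto (fun m => ∑' j, truncHat α A n m j * y j) atTop (𝓝 (∑' j, hat α A n j * y j)) := by
  obtain ⟨M, hM⟩ := mem_ellInf_iff.1 hy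
  exact tendsto_tsum_mul_of_bounded (summable_norm_truncHat n) (hs n)
    ((tendsto_sum_norm_wMat_iff h (hs n)).1 (h1 n)) hM

theorem mem_matClass_ellInf_iff {Y : Set (ℕ → ℂ)} :
    A ∈ MatClass (fracSpace ellInf α) Y ↔
      HatDefined α A ∧ (∀ n, Summable fun k => ‖hat α A n k‖) ∧ Cond1B α A ∧
        ∀ y ∈ ellInf, (fun n => ∑' k, hat α A n k * y k) ∈ Y := by
  rw [mem_matClass_fracSpace]
  constructor
  · intro h
    have hd : HatDefined α A := hatDefined_of_forall_single fun n j =>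
      (h _ (cZero_subset_ellInf (single_mem_cZero j))).1 n
    have hb : ∀ n, (Summable fun k => ‖hat α A n k‖) ∧
        Tendsto (fun m => ∑' k, ‖truncHat α A n m k - hat α A n k‖) atTop (𝓝 0) := by
      intro n
      obtain ⟨a, ha, hsa, hlim⟩ := exists_tendsto_tsum_norm_sub (summable_norm_truncHat n)
        fun y hy => by
          obtain ⟨s, hs⟩ := converges_mul_fracDiff_iff.1 ((h y (mem_ellInf_iff.2 ⟨1, hy⟩)).1 n)
          exact hs.cauchySeq
      -- The ℓ₁ limit supplied by Schur's theorem is identified column by column.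
      obtain rfl : a = hat α A n := funext fun k =>
        tendsto_nhds_unique (ha k) (tendsto_truncHat hd n k)
      exact ⟨hsa, hlim⟩
    have h1 : Cond1B α A := fun n => (tendsto_sum_norm_wMat_iff hd (hb n).1).2 (hb n).2
    refine ⟨hd, fun n => (hb n).1, h1, fun y hy => ?_⟩
    convert (h y hy).2 using 2 with n
    exact (series_mul_fracDiff (tendsto_of_cond1B hd (fun n => (hb n).1) h1 hy n)).symm
  · rintro ⟨hd, hs, h1, hY⟩ y hy
    have ht := tendsto_of_cond1B hd hs h1 hy
    refine ⟨fun n => converges_mul_fracDiff_iff.2 ⟨_, ht n⟩, ?_⟩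
    simpa only [series_mul_fracDiff (ht _)] using hY y hy

/-- The ranges on the right include k = m, matching 3A; this is harmless because w_{mm} = â_{nm}, so
the extra terms cancel. -/
theorem sum_range_mul_fracDiff_one (h : HatDefined α A) (n m : ℕ) :
    ∑ k ∈ Finset.range m, A n k * fracDiff (-α) 1 k
      = ∑ k ∈ Finset.range (m + 1), hat α A n k - ∑ k ∈ Finset.range (m + 1), wMat α A n m k := by
  rw [← Finset.sum_sub_distrib, sum_range_mul_fracDiff,
    Finset.sum_range_succ (fun k => hat α A n k - wMat α A n m k), wMat_eq h le_rfl,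
    truncHat_of_le le_rfl, sub_zero, sub_self, add_zero]
  refine Finset.sum_congr rfl fun k hk => ?_
  rw [wMat_eq h (Finset.mem_range.1 hk).le]
  simp

theorem fracDiff_eq_add_mul_one (β : ℝ) (y : ℕ → ℂ) (l : ℂ) (k : ℕ) :
    fracDiff β y k = fracDiff β (fun j => y j - l) k + l * fracDiff β 1 k := by
  simp only [fracDiff, Finset.mul_sum, ← Finset.sum_add_distrib]
  exact Finset.sum_congr rfl fun i _ => by simp; ring

/-- Since c = c₀ ⊕ ℂ·1 and Y is closed under sums and scalar multiples, only the constant sequence 1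
has to be tested beyond c₀. -/
theorem mem_matClass_cConv_iff {Y : Set (ℕ → ℂ)} (hadd : ∀ y ∈ Y, ∀ z ∈ Y, y + z ∈ Y)
    (hsmul : ∀ (c : ℂ), ∀ y ∈ Y, c • y ∈ Y) :
    A ∈ MatClass (fracSpace cConv α) Y ↔
      A ∈ MatClass (fracSpace cZero α) Y ∧
        ∃ γ, Cond3A α A γ ∧ (fun n => series (hat α A n) - γ n) ∈ Y := by
  have hhat : A ∈ MatClass (fracSpace cZero α) Y → ∀ n,
      Tendsto (fun m => ∑ k ∈ Finset.range (m + 1), hat α A n k) atTop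
        (𝓝 (series (hat α A n))) := fun h n => by
    have hs := (mem_matClass_cZero_iff.1 h).2.1 n
    rw [series_eq_tsum hs]
    exact (tendsto_add_atTop_iff_nat 1).2 hs.of_norm.hasSum.tendsto_sum_nat
  constructor
  · intro h
    have h0 : A ∈ MatClass (fracSpace cZero α) Y :=
      fun x hx => h x (cZero_subset_cConv hx)
    have hd := (mem_matClass_cZero_iff.1 h0).1
    obtain ⟨hc, hY⟩ := mem_matClass_fracSpace.1 h 1 ⟨1, tendsto_const_nhds⟩
    -- γ is chosen so that ∑_k â_{nk} - γ_n is the image of the constant sequence 1.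
    refine ⟨h0, fun n => series (hat α A n) - series fun k => A n k * fracDiff (-α) 1 k,
      fun n => ?_, by simpa using hY⟩
    refine ((hhat h0 n).sub (hc n).tendsto).congr fun m => ?_
    rw [sum_range_mul_fracDiff_one hd]
    ring
  · rintro ⟨h0, γ, hγ, hY⟩
    have hd := (mem_matClass_cZero_iff.1 h0).1
    rw [mem_matClass_fracSpace] at h0 ⊢
    rintro y ⟨l, hl⟩
    obtain ⟨hc, hY'⟩ := h0 (fun j => y j - l) (by simpa using! hl.sub_const l)
    have ht : ∀ n, Tendsto (fun m => ∑ k ∈ Finset.range m, A n k * fracDiff (-α) y k) atTop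
        (𝓝 ((series fun k => A n k * fracDiff (-α) (fun j => y j - l) k)
          + l * (series (hat α A n) - γ n))) := by
      intro n
      refine ((hc n).tendsto.add (((hhat (mem_matClass_fracSpace.2 h0) n).sub
        (hγ n)).const_mul l)).congr fun m => ?_
      rw [← sum_range_mul_fracDiff_one hd, Finset.mul_sum, ← Finset.sum_add_distrib]
      refine Finset.sum_congr rfl fun k _ => ?_
      rw [fracDiff_eq_add_mul_one (-α) y l k]
      ring
    refine ⟨fun n => (converges_iff _).2 ⟨_, ht n⟩, ?_⟩
    simp only [series_eq (ht _)]
    exact hadd _ hY' _ (hsmul l _ hY)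

/-! ### Classical matrix classes, for matrices with absolutely summable rows -/

section Rows

variable {B : ℕ → ℕ → ℂ}

theorem tsum_mul_single (n k : ℕ) : ∑' j, B n j * (Pi.single k 1 : ℕ → ℂ) j = B n k := by
  simp [Pi.single_apply]

theorem null_bounded_iff (hs : ∀ n, Summable fun k => ‖B n k‖) :
    (∀ y ∈ cZero, (fun n => ∑' k, B n k * y k) ∈ ellInf) ↔ (⨆ n, ∑' k, ‖B n k‖ₑ) < ∞ := by
  rw [iSup_tsum_enorm_lt_top_iff hs]
  constructor
  · exact fun h => exists_tsum_norm_le_of_null hs fun y hy => mem_ellInf_iff.1 (h y hy)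
  · rintro ⟨C, hC⟩ y hy
    obtain ⟨M, hM⟩ := exists_norm_le_of_tendsto hy
    exact mem_ellInf_iff.2 ⟨C * M, fun n => (norm_tsum_mul_le (hs n) hM).trans
      (mul_le_mul_of_nonneg_right (hC n) ((norm_nonneg _).trans (hM 0)))⟩

theorem bounded_bounded_iff (hs : ∀ n, Summable fun k => ‖B n k‖) :
    (∀ y ∈ ellInf, (fun n => ∑' k, B n k * y k) ∈ ellInf) ↔ (⨆ n, ∑' k, ‖B n k‖ₑ) < ∞ := by
  constructor
  · exact fun h => (null_bounded_iff hs).1 fun y hy => h y (cZero_subset_ellInf hy)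
  · intro h y hy
    obtain ⟨C, hC⟩ := (iSup_tsum_enorm_lt_top_iff hs).1 h
    obtain ⟨M, hM⟩ := mem_ellInf_iff.1 hy
    exact mem_ellInf_iff.2 ⟨C * M, fun n => (norm_tsum_mul_le (hs n) hM).trans
      (mul_le_mul_of_nonneg_right (hC n) ((norm_nonneg _).trans (hM 0)))⟩

theorem null_null_iff (hs : ∀ n, Summable fun k => ‖B n k‖) :
    (∀ y ∈ cZero, (fun n => ∑' k, B n k * y k) ∈ cZero) ↔
      (⨆ n, ∑' k, ‖B n k‖ₑ) < ∞ ∧ ∀ k, Tendsto (fun n => B n k) atTop (𝓝 0) := by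
  constructor
  · refine fun h => ⟨(null_bounded_iff hs).1 fun y hy => cZero_subset_ellInf (h y hy),
      fun k => ?_⟩
    simpa only [tsum_mul_single] using! h _ (single_mem_cZero k)
  · rintro ⟨h, hcol⟩ y hy
    obtain ⟨C, hC⟩ := (iSup_tsum_enorm_lt_top_iff hs).1 h
    exact tendsto_tsum_mul_zero hs hC hcol hy

theorem null_convergent_iff (hs : ∀ n, Summable fun k => ‖B n k‖) :
    (∀ y ∈ cZero, (fun n => ∑' k, B n k * y k) ∈ cConv) ↔
      (⨆ n, ∑' k, ‖B n k‖ₑ) < ∞ ∧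
        ∃ a : ℕ → ℂ, ∀ k, Tendsto (fun n => B n k) atTop (𝓝 (a k)) := by
  constructor
  · refine fun h => ⟨(null_bounded_iff hs).1 fun y hy => ?_, ?_⟩
    · obtain ⟨l, hl⟩ := h y hy
      exact mem_ellInf_iff.2 (exists_norm_le_of_tendsto hl)
    · choose a ha using fun k => h _ (single_mem_cZero k)
      exact ⟨a, fun k => by simpa only [tsum_mul_single] using ha k⟩
  · rintro ⟨h, a, hcol⟩ y hy
    obtain ⟨C, hC⟩ := (iSup_tsum_enorm_lt_top_iff hs).1 h
    exact ⟨_, tendsto_tsum_mul_of_null hs hC hcol hy⟩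

theorem bounded_convergent_iff (hs : ∀ n, Summable fun k => ‖B n k‖) :
    (∀ y ∈ ellInf, (fun n => ∑' k, B n k * y k) ∈ cConv) ↔
      ∃ a : ℕ → ℂ, (∀ k, Tendsto (fun n => B n k) atTop (𝓝 (a k))) ∧
        (Summable fun k => ‖a k‖) ∧ Tendsto (fun n => ∑' k, ‖B n k - a k‖) atTop (𝓝 0) := by
  constructor
  · refine fun h => exists_tendsto_tsum_norm_sub hs fun y hy => ?_
    obtain ⟨l, hl⟩ := h y (mem_ellInf_iff.2 ⟨1, hy⟩)
    exact hl.cauchySeq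
  · rintro ⟨a, -, hsa, hlim⟩ y hy
    obtain ⟨M, hM⟩ := mem_ellInf_iff.1 hy
    exact ⟨_, tendsto_tsum_mul_of_bounded hs hsa hlim hM⟩

theorem bounded_null_iff (hs : ∀ n, Summable fun k => ‖B n k‖) :
    (∀ y ∈ ellInf, (fun n => ∑' k, B n k * y k) ∈ cZero) ↔
      Tendsto (fun n => ∑' k, ‖B n k‖) atTop (𝓝 0) := by
  constructor
  · intro h
    obtain ⟨a, ha, -, hlim⟩ := (bounded_convergent_iff hs).1 fun y hy =>
      cZero_subset_cConv (h y hy)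
    -- Unit sequences show that every column is null, so the ℓ₁ limit of the rows is 0.
    obtain rfl : a = 0 := funext fun k => tendsto_nhds_unique (ha k) (by
      simpa only [tsum_mul_single] using! h _ (cZero_subset_ellInf (single_mem_cZero k)))
    simpa using hlim
  · intro h y hy
    obtain ⟨M, hM⟩ := mem_ellInf_iff.1 hy
    have := tendsto_tsum_mul_of_bounded (a := 0) hs (by simp)
      (by simpa using h) hM
    simpa using! this

theorem tsum_indicator_eq (K : Set ℕ) (n : ℕ) :
    ∑' k, K.indicator (B n) k = ∑' k, B n k * K.indicator 1 k :=
  tsum_congr fun k => by by_cases hk : k ∈ K <;> simp [hk]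

theorem iSup_series_indicator_lt_top_iff (hs : ∀ n, Summable fun k => ‖B n k‖) :
    (⨆ K : Set ℕ, ∑' n, ‖series (K.indicator (B n))‖ₑ) < ∞ ↔
      ∃ C, ∀ (K : Set ℕ) (N : Finset ℕ), ∑ n ∈ N, ‖∑' k, K.indicator (B n) k‖ ≤ C := by
  have e : ∀ (K : Set ℕ) n, series (K.indicator (B n)) = ∑' k, K.indicator (B n) k :=
    fun K n => series_eq_tsum ((hs n).of_norm.indicator K).norm
  simp only [e]
  constructor
  · intro h
    obtain ⟨C, hC⟩ := (iSup_tsum_enorm_lt_top_iff (summable_norm_of_iSup_lt_top h)).1 h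
    exact ⟨C, fun K N => ((summable_norm_of_iSup_lt_top h K).sum_le_tsum N
      fun _ _ => norm_nonneg _).trans (hC K)⟩
  · rintro ⟨C, hC⟩
    have hsum := fun K => summable_of_sum_le (fun _ => norm_nonneg _) (hC K)
    exact (iSup_tsum_enorm_lt_top_iff hsum).2
      ⟨C, fun K => (hsum K).tsum_le_of_sum_le (hC K)⟩

theorem bounded_summable_of_iSup (hs : ∀ n, Summable fun k => ‖B n k‖)
    (h : (⨆ K : Set ℕ, ∑' n, ‖series (K.indicator (B n))‖ₑ) < ∞) :
    ∀ y ∈ ellInf, (fun n => ∑' k, B n k * y k) ∈ ellOne := by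
  intro y hy
  obtain ⟨C, hC⟩ := (iSup_series_indicator_lt_top_iff hs).1 h
  obtain ⟨M, hM⟩ := mem_ellInf_iff.1 hy
  refine summable_norm_tsum_mul_of_indicator hs (fun K N => ?_) hM (C := C)
  -- Only finite K are needed for this direction.
  simpa only [← sum_eq_tsum_indicator] using hC K N

theorem null_summable_iff (hs : ∀ n, Summable fun k => ‖B n k‖) :
    (∀ y ∈ cZero, (fun n => ∑' k, B n k * y k) ∈ ellOne) ↔
      (⨆ K : Set ℕ, ∑' n, ‖series (K.indicator (B n))‖ₑ) < ∞ := by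
  refine ⟨fun h => ?_, fun h y hy => bounded_summable_of_iSup hs h y (cZero_subset_ellInf hy)⟩
  -- Indicators of infinite K are not null, so a bound valid on the whole unit ball of ℓ_∞ is
  -- needed.
  obtain ⟨C, hC⟩ := exists_sum_norm_tsum_mul_le hs h
  refine (iSup_series_indicator_lt_top_iff hs).2 ⟨C, fun K N => ?_⟩
  simp only [tsum_indicator_eq]
  refine hC _ (fun k => ?_) N
  by_cases hk : k ∈ K <;> simp [hk]

theorem bounded_summable_iff (hs : ∀ n, Summable fun k => ‖B n k‖) :
    (∀ y ∈ ellInf, (fun n => ∑' k, B n k * y k) ∈ ellOne) ↔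
      (⨆ K : Set ℕ, ∑' n, ‖series (K.indicator (B n))‖ₑ) < ∞ :=
  ⟨fun h => (null_summable_iff hs).1 fun y hy => h y (cZero_subset_ellInf hy),
    bounded_summable_of_iSup hs⟩

end Rows

/-! ### Absolute summability of rows contained in conditions 10A, 4A and 7B -/

/-- Take K = {g ≥ 0} and its complement: the difference of the two convergent series is ∑ |g|. -/
theorem summable_abs_of_indicator {g : ℕ → ℝ}
    (h : ∀ K : Set ℕ, ∃ s, Tendsto (fun N => ∑ k ∈ Finset.range N, K.indicator g k) atTop (𝓝 s)) :
    Summable fun k => |g k| := by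
  obtain ⟨s, hs⟩ := h {k | 0 ≤ g k}
  obtain ⟨t, ht⟩ := h {k | 0 ≤ g k}ᶜ
  refine ⟨s - t, (hasSum_iff_tendsto_nat_of_nonneg (fun k => abs_nonneg (g k)) _).2
    ((hs.sub ht).congr fun N => ?_)⟩
  rw [← Finset.sum_sub_distrib]
  refine Finset.sum_congr rfl fun k _ => ?_
  by_cases hk : 0 ≤ g k
  · simp [hk, abs_of_nonneg hk]
  · simp [hk, abs_of_neg (not_le.1 hk)]

theorem summable_norm_of_converges_indicator {f : ℕ → ℂ}
    (h : ∀ K : Set ℕ, Converges (K.indicator f)) : Summable fun k => ‖f k‖ := by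
  have key : ∀ L : ℂ →L[ℝ] ℝ, Summable fun k => |L (f k)| := fun L =>
    summable_abs_of_indicator fun K => by
      refine ⟨_, ((L.continuous.tendsto _).comp (h K).tendsto).congr fun N => ?_⟩
      simp only [Function.comp_apply, map_sum]
      refine Finset.sum_congr rfl fun k _ => ?_
      by_cases hk : k ∈ K <;> simp [hk]
  exact Summable.of_nonneg_of_le (fun _ => norm_nonneg _)
    (fun k => Complex.norm_le_abs_re_add_abs_im (f k))
    ((key Complex.reCLM).add (key Complex.imCLM))

/-- Convergence over every K forces absolute summability of each row of Â, so 10A can stand without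
1A in the table. -/
theorem cond10A_iff : Cond10A α A ↔ (∀ n, Summable fun k => ‖hat α A n k‖) ∧
    (⨆ K : Set ℕ, ∑' n, ‖series (K.indicator (hat α A n))‖ₑ) < ∞ := by
  refine ⟨fun h => ⟨fun n => summable_norm_of_converges_indicator fun K => h.1 K n, h.2⟩,
    fun h => ⟨fun K n => ?_, h.2⟩⟩
  exact (converges_iff _).2 ⟨_, ((h.1 n).of_norm.indicator K).hasSum.tendsto_sum_nat⟩

theorem cond4A_iff : Cond4A α A ↔ (∀ n, Summable fun k => ‖hat α A n k‖) ∧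
    Tendsto (fun n => ∑' k, ‖hat α A n k‖) atTop (𝓝 0) := by
  simp only [Cond4A, tsum_enorm_lt_top_iff]
  exact and_congr_right fun hs => tendsto_tsum_enorm_iff hs

theorem cond7BC_iff {a : ℕ → ℂ} : Cond7B α A a ∧ Cond7C α A a ↔
    (∀ n, Summable fun k => ‖hat α A n k‖) ∧ (Summable fun k => ‖a k‖) ∧
      Tendsto (fun n => ∑' k, ‖hat α A n k - a k‖) atTop (𝓝 0) := by
  simp only [Cond7B, Cond7C, tsum_enorm_lt_top_iff, and_assoc]
  refine and_congr_right fun hs => and_congr_right fun hsa => tendsto_tsum_enorm_iff fun n => ?_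
  exact Summable.of_nonneg_of_le (fun _ => norm_nonneg _) (fun k => norm_sub_le _ _)
    ((hs n).add hsa)

/-! ### The twelve classes -/

theorem mem_ellInf_ellInf_iff : A ∈ MatClass (fracSpace ellInf α) ellInf ↔
    HatDefined α A ∧ Cond1A α A ∧ Cond1B α A := by
  rw [mem_matClass_ellInf_iff]
  constructor
  · exact fun ⟨hd, hs, h1, h⟩ => ⟨hd, (bounded_bounded_iff hs).1 h, h1⟩
  · exact fun ⟨hd, h, h1⟩ => ⟨hd, summable_norm_of_iSup_lt_top h, h1,
      (bounded_bounded_iff (summable_norm_of_iSup_lt_top h)).2 h⟩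

theorem mem_cZero_ellInf_iff : A ∈ MatClass (fracSpace cZero α) ellInf ↔
    HatDefined α A ∧ Cond1A α A ∧ Cond2A α A := by
  rw [mem_matClass_cZero_iff]
  constructor
  · exact fun ⟨hd, hs, h2, h⟩ => ⟨hd, (null_bounded_iff hs).1 h, h2⟩
  · exact fun ⟨hd, h, h2⟩ => ⟨hd, summable_norm_of_iSup_lt_top h, h2,
      (null_bounded_iff (summable_norm_of_iSup_lt_top h)).2 h⟩

theorem mem_cConv_ellInf_iff : A ∈ MatClass (fracSpace cConv α) ellInf ↔
    HatDefined α A ∧ Cond1A α A ∧ Cond2A α A ∧ ∃ γ, Cond3A α A γ ∧ Cond3B α A γ := by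
  rw [mem_matClass_cConv_iff, mem_cZero_ellInf_iff]
  · simp only [mem_ellInf_iff_iSup, and_assoc, Cond3B]
  · intro y hy z hz
    obtain ⟨C, hC⟩ := mem_ellInf_iff.1 hy
    obtain ⟨D, hD⟩ := mem_ellInf_iff.1 hz
    exact mem_ellInf_iff.2 ⟨C + D, fun n => norm_add_le_of_le (hC n) (hD n)⟩
  · intro c y hy
    obtain ⟨C, hC⟩ := mem_ellInf_iff.1 hy
    refine mem_ellInf_iff.2 ⟨‖c‖ * C, fun n => ?_⟩
    simpa using mul_le_mul_of_nonneg_left (hC n) (norm_nonneg c)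

theorem mem_ellInf_cZero_iff : A ∈ MatClass (fracSpace ellInf α) cZero ↔
    HatDefined α A ∧ Cond1B α A ∧ Cond4A α A := by
  rw [mem_matClass_ellInf_iff, cond4A_iff]
  constructor
  · exact fun ⟨hd, hs, h1, h⟩ => ⟨hd, h1, hs, (bounded_null_iff hs).1 h⟩
  · exact fun ⟨hd, h1, hs, h⟩ => ⟨hd, hs, h1, (bounded_null_iff hs).2 h⟩

theorem mem_cZero_cZero_iff : A ∈ MatClass (fracSpace cZero α) cZero ↔
    HatDefined α A ∧ Cond1A α A ∧ Cond2A α A ∧ Cond5A α A := by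
  rw [mem_matClass_cZero_iff]
  constructor
  · rintro ⟨hd, hs, h2, h⟩
    obtain ⟨h1, h5⟩ := (null_null_iff hs).1 h
    exact ⟨hd, h1, h2, h5⟩
  · exact fun ⟨hd, h, h2, h5⟩ => ⟨hd, summable_norm_of_iSup_lt_top h, h2,
      (null_null_iff (summable_norm_of_iSup_lt_top h)).2 ⟨h, h5⟩⟩

theorem mem_cConv_cZero_iff : A ∈ MatClass (fracSpace cConv α) cZero ↔
    HatDefined α A ∧ Cond1A α A ∧ Cond2A α A ∧ Cond5A α A ∧
      ∃ γ, Cond3A α A γ ∧ Cond6A α A γ := by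
  rw [mem_matClass_cConv_iff, mem_cZero_cZero_iff]
  · simp only [and_assoc]
    rfl
  · intro y hy z hz
    simpa using! Tendsto.add hy hz
  · intro c y hy
    simpa using! Tendsto.const_smul hy c

theorem mem_ellInf_cConv_iff : A ∈ MatClass (fracSpace ellInf α) cConv ↔
    HatDefined α A ∧ Cond1B α A ∧ ∃ a, Cond7A α A a ∧ Cond7B α A a ∧ Cond7C α A a := by
  rw [mem_matClass_ellInf_iff]
  simp only [cond7BC_iff]
  constructor
  · rintro ⟨hd, hs, h1, h⟩
    obtain ⟨a, ha, h'⟩ := (bounded_convergent_iff hs).1 h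
    exact ⟨hd, h1, a, ha, hs, h'⟩
  · exact fun ⟨hd, h1, a, ha, hs, h'⟩ => ⟨hd, hs, h1, (bounded_convergent_iff hs).2 ⟨a, ha, h'⟩⟩

theorem mem_cZero_cConv_iff : A ∈ MatClass (fracSpace cZero α) cConv ↔
    HatDefined α A ∧ Cond1A α A ∧ Cond2A α A ∧ ∃ a, Cond7A α A a := by
  rw [mem_matClass_cZero_iff]
  constructor
  · rintro ⟨hd, hs, h2, h⟩
    obtain ⟨h1, h7⟩ := (null_convergent_iff hs).1 h
    exact ⟨hd, h1, h2, h7⟩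
  · exact fun ⟨hd, h, h2, h7⟩ => ⟨hd, summable_norm_of_iSup_lt_top h, h2,
      (null_convergent_iff (summable_norm_of_iSup_lt_top h)).2 ⟨h, h7⟩⟩

theorem mem_cConv_cConv_iff : A ∈ MatClass (fracSpace cConv α) cConv ↔
    HatDefined α A ∧ Cond1A α A ∧ Cond2A α A ∧ (∃ a, Cond7A α A a) ∧
      ∃ γ, Cond3A α A γ ∧ Cond9A α A γ := by
  rw [mem_matClass_cConv_iff, mem_cZero_cConv_iff]
  · simp only [and_assoc]
    rfl
  · rintro y ⟨l, hl⟩ z ⟨l', hl'⟩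
    exact ⟨l + l', hl.add hl'⟩
  · rintro c y ⟨l, hl⟩
    exact ⟨c • l, hl.const_smul c⟩

theorem mem_ellInf_ellOne_iff : A ∈ MatClass (fracSpace ellInf α) ellOne ↔
    HatDefined α A ∧ Cond1B α A ∧ Cond10A α A := by
  rw [mem_matClass_ellInf_iff, cond10A_iff]
  constructor
  · exact fun ⟨hd, hs, h1, h⟩ => ⟨hd, h1, hs, (bounded_summable_iff hs).1 h⟩
  · exact fun ⟨hd, h1, hs, h⟩ => ⟨hd, hs, h1, (bounded_summable_iff hs).2 h⟩

theorem mem_cZero_ellOne_iff : A ∈ MatClass (fracSpace cZero α) ellOne ↔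
    HatDefined α A ∧ Cond2A α A ∧ Cond10A α A := by
  rw [mem_matClass_cZero_iff, cond10A_iff]
  constructor
  · exact fun ⟨hd, hs, h2, h⟩ => ⟨hd, h2, hs, (null_summable_iff hs).1 h⟩
  · exact fun ⟨hd, h2, hs, h⟩ => ⟨hd, hs, h2, (null_summable_iff hs).2 h⟩

theorem mem_cConv_ellOne_iff : A ∈ MatClass (fracSpace cConv α) ellOne ↔
    HatDefined α A ∧ Cond2A α A ∧ Cond10A α A ∧ ∃ γ, Cond3A α A γ ∧ Cond12A α A γ := by
  rw [mem_matClass_cConv_iff, mem_cZero_ellOne_iff]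
  · simp only [mem_ellOne_iff, and_assoc, Cond12A]
  · intro y hy z hz
    exact Summable.of_nonneg_of_le (fun _ => norm_nonneg _) (fun n => norm_add_le _ _)
      (Summable.add hy hz)
  · intro c y hy
    simpa [ellOne] using Summable.mul_left ‖c‖ hy

end FracDiff

theorem mainTheorem5 (α : ℝ) (A : ℕ → ℕ → ℂ) :
    -- into the bounded sequences
    (A ∈ FracDiff.MatClass (FracDiff.fracSpace FracDiff.ellInf α) FracDiff.ellInf ↔
      FracDiff.HatDefined α A ∧ FracDiff.Cond1A α A ∧ FracDiff.Cond1B α A) ∧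
    (A ∈ FracDiff.MatClass (FracDiff.fracSpace FracDiff.cZero α) FracDiff.ellInf ↔
      FracDiff.HatDefined α A ∧ FracDiff.Cond1A α A ∧ FracDiff.Cond2A α A) ∧
    (A ∈ FracDiff.MatClass (FracDiff.fracSpace FracDiff.cConv α) FracDiff.ellInf ↔
      FracDiff.HatDefined α A ∧ FracDiff.Cond1A α A ∧ FracDiff.Cond2A α A ∧
        ∃ γ, FracDiff.Cond3A α A γ ∧ FracDiff.Cond3B α A γ) ∧
    -- into the null sequences
    (A ∈ FracDiff.MatClass (FracDiff.fracSpace FracDiff.ellInf α) FracDiff.cZero ↔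
      FracDiff.HatDefined α A ∧ FracDiff.Cond1B α A ∧ FracDiff.Cond4A α A) ∧
    (A ∈ FracDiff.MatClass (FracDiff.fracSpace FracDiff.cZero α) FracDiff.cZero ↔
      FracDiff.HatDefined α A ∧ FracDiff.Cond1A α A ∧ FracDiff.Cond2A α A ∧
        FracDiff.Cond5A α A) ∧
    (A ∈ FracDiff.MatClass (FracDiff.fracSpace FracDiff.cConv α) FracDiff.cZero ↔
      FracDiff.HatDefined α A ∧ FracDiff.Cond1A α A ∧ FracDiff.Cond2A α A ∧
        FracDiff.Cond5A α A ∧ ∃ γ, FracDiff.Cond3A α A γ ∧ FracDiff.Cond6A α A γ) ∧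
    -- into the convergent sequences
    (A ∈ FracDiff.MatClass (FracDiff.fracSpace FracDiff.ellInf α) FracDiff.cConv ↔
      FracDiff.HatDefined α A ∧ FracDiff.Cond1B α A ∧
        ∃ a, FracDiff.Cond7A α A a ∧ FracDiff.Cond7B α A a ∧ FracDiff.Cond7C α A a) ∧
    (A ∈ FracDiff.MatClass (FracDiff.fracSpace FracDiff.cZero α) FracDiff.cConv ↔
      FracDiff.HatDefined α A ∧ FracDiff.Cond1A α A ∧ FracDiff.Cond2A α A ∧
        ∃ a, FracDiff.Cond7A α A a) ∧
    (A ∈ FracDiff.MatClass (FracDiff.fracSpace FracDiff.cConv α) FracDiff.cConv ↔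
      FracDiff.HatDefined α A ∧ FracDiff.Cond1A α A ∧ FracDiff.Cond2A α A ∧
        (∃ a, FracDiff.Cond7A α A a) ∧
        ∃ γ, FracDiff.Cond3A α A γ ∧ FracDiff.Cond9A α A γ) ∧
    -- into the absolutely summable sequences
    (A ∈ FracDiff.MatClass (FracDiff.fracSpace FracDiff.ellInf α) FracDiff.ellOne ↔
      FracDiff.HatDefined α A ∧ FracDiff.Cond1B α A ∧ FracDiff.Cond10A α A) ∧
    (A ∈ FracDiff.MatClass (FracDiff.fracSpace FracDiff.cZero α) FracDiff.ellOne ↔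
      FracDiff.HatDefined α A ∧ FracDiff.Cond2A α A ∧ FracDiff.Cond10A α A) ∧
    (A ∈ FracDiff.MatClass (FracDiff.fracSpace FracDiff.cConv α) FracDiff.ellOne ↔
      FracDiff.HatDefined α A ∧ FracDiff.Cond2A α A ∧ FracDiff.Cond10A α A ∧
        ∃ γ, FracDiff.Cond3A α A γ ∧ FracDiff.Cond12A α A γ) := by
  open FracDiff in
  exact ⟨mem_ellInf_ellInf_iff, mem_cZero_ellInf_iff, mem_cConv_ellInf_iff,
    mem_ellInf_cZero_iff, mem_cZero_cZero_iff, mem_cConv_cZero_iff,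
    mem_ellInf_cConv_iff, mem_cZero_cConv_iff, mem_cConv_cConv_iff,
    mem_ellInf_ellOne_iff, mem_cZero_ellOne_iff, mem_cConv_ellOne_iff⟩
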